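/- For a finite graph $G$, consider the following game with perfect information between a team of $k$ cops and one robber. Each cop chooses an initial vertex of $G$ (several cops may share a vertex), and then the robber chooses his initial vertex. After that, the players alternate turns, the cops first. On a cop turn, each cop stays where she is or moves to an adjacent vertex. On a robber turn, the robber moves along a path of $G$ of any length (possibly $0$), no vertex of which is occupied by a cop. The cops win if at some time a cop occupies the same vertex as the robber; the robber wins if he evades capture forever. The infinite-speed cop number $c_\infty(G)$ is the least $k$ such that $k$ cops can guarantee a win no matter how the robber plays. Let $P_n$ be the path on $n$ vertices and let $\Box$ denote the Cartesian product of graphs. **Theorem.** For all sufficiently large $n$, $$c_\infty\left(P_n \,\Box\, P_n \,\Box\, P_n\right) > 0.7172\, n^2 .$$ -/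

import Mathlib

namespace CopsRobber

variable {V : Type*}

/-- A strategy for a team of `k` cops: to the list `[r₀, …, rᵢ₋₁]` of positions the robber has
occupied so far (his initial position, then his position after each of his turns) it assigns the
cops' positions after their `i`-th turn. The empty list gives their initial positions. -/
abbrev CopStrategy (V : Type*) (k : ℕ) := List V → Fin k → V

/-- On each of their turns, each cop stays where she is or moves to a neighbouring vertex. -/
def CopStrategy.Legal (G : SimpleGraph V) {k : ℕ} (σ : CopStrategy V k) : Prop :=
  ∀ (h : List V) (v : V) (j : Fin k), σ (h ++ [v]) j = σ h j ∨ G.Adj (σ h j) (σ (h ++ [v]) j)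

/-- The set of vertices occupied by cops after their `i`-th turn (`i = 0`: initially), when they
follow `σ` and the robber's successive positions are `r 0, r 1, …`. -/
def CopStrategy.occupied {k : ℕ} (σ : CopStrategy V k) (r : ℕ → V) (i : ℕ) : Set V :=
  Set.range (σ ((List.range i).map r))

/-- The robber, with infinite speed, perpetually evades `k` cops who follow `σ` by occupying
`r 0, r 1, …`. He starts on a vertex without a cop; and for every `i`, after the cops' turn
number `i + 1`, he goes from `r i` to `r (i + 1)` along a path, of any length (possibly `0`), no
vertex of which carries a cop. As the ends `r i` and `r (i + 1)` belong to that path, this says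
too that no cop moved onto `r i` and that he does not step onto a cop. -/
def Evades (G : SimpleGraph V) {k : ℕ} (σ : CopStrategy V k) (r : ℕ → V) : Prop :=
  r 0 ∉ σ.occupied r 0 ∧
    ∀ i, ∃ p : G.Walk (r i) (r (i + 1)), p.IsPath ∧ ∀ v ∈ p.support, v ∉ σ.occupied r (i + 1)

/-- `k` cops can guarantee the capture of an infinitely fast robber on `G`, no matter how he
plays. -/
def CopsWin (G : SimpleGraph V) (k : ℕ) : Prop :=
  ∃ σ : CopStrategy V k, σ.Legal G ∧ ∀ r : ℕ → V, ¬ Evades G σ r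

/-- On a finite graph some number of cops wins, namely one cop for each vertex. -/
theorem copsWin_card [Fintype V] (G : SimpleGraph V) : CopsWin G (Fintype.card V) := by
  refine ⟨fun _ => (Fintype.equivFin V).symm, fun _ _ _ => Or.inl rfl, fun r hr => hr.1 ?_⟩
  exact ⟨Fintype.equivFin V (r 0), by simp⟩

/-- The infinite-speed cop number of a finite graph: the least number of cops that can guarantee
the capture of an infinitely fast robber. The set is nonempty by `copsWin_card`. -/
noncomputable def infSpeedCopNumber [Finite V] (G : SimpleGraph V) : ℕ :=
  sInf {k : ℕ | CopsWin G k}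

/-- The `n × n × n` grid, the Cartesian product of three paths with `n` vertices each. -/
abbrev grid3 (n : ℕ) : SimpleGraph (Fin n × Fin n × Fin n) :=
  (SimpleGraph.pathGraph n).boxProd
    ((SimpleGraph.pathGraph n).boxProd (SimpleGraph.pathGraph n))

end CopsRobber

namespace CopsRobber

open Finset

/-- The potential used to bound the number of cops in consecutive slabs. -/
noncomputable def levelGain (c x : ℝ) : ℝ := (max (√(2 * x) - c) 0) ^ 2 / 2

theorem levelGain_nonneg (c x : ℝ) : 0 ≤ levelGain c x := by
  unfold levelGain; positivity

theorem levelGain_mono (c : ℝ) {x y : ℝ} (h : x ≤ y) : levelGain c x ≤ levelGain c y := by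
  unfold levelGain
  have : √(2 * x) ≤ √(2 * y) := Real.sqrt_le_sqrt (by linarith)
  gcongr

theorem levelGain_half_sq {c n : ℝ} (hn : 0 ≤ n) (hc : c ≤ n) :
    levelGain c (n ^ 2 / 2) = (n - c) ^ 2 / 2 := by
  unfold levelGain
  rw [show 2 * (n ^ 2 / 2) = n ^ 2 by ring, Real.sqrt_sq hn, max_eq_left (by linarith)]

theorem levelGain_le {c C x : ℝ} (hc : 0 ≤ c) (hC : 0 ≤ C) (hx : x ≤ (c + C) ^ 2 / 2) :
    levelGain c x ≤ C ^ 2 / 2 := by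
  unfold levelGain
  have h1 : √(2 * x) ≤ c + C := by
    rw [Real.sqrt_le_left (by linarith)]; linarith
  have h2 : max (√(2 * x) - c) 0 ≤ C := max_le (by linarith) hC
  have h3 : 0 ≤ max (√(2 * x) - c) 0 := le_max_right _ _
  gcongr

theorem levelGain_step {a b s c C : ℝ} (hc : 0 ≤ c) (hcs : c ≤ s) (hC : 0 ≤ C)
    (hab : b ≤ a + s) (hb : b ≤ (s + C) ^ 2 / 2) :
    levelGain c b - levelGain c a ≤ s - c + C := by
  rcases le_or_gt b a with h | h
  · have := levelGain_mono c h
    linarith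
  rcases le_or_gt (√(2 * b)) c with h' | h'
  · have h1 : levelGain c b = 0 := by
      unfold levelGain; rw [max_eq_right (by linarith)]; norm_num
    have := levelGain_nonneg c a
    linarith
  set p := √(2 * b) with hp
  have hp0 : 0 < p := lt_of_le_of_lt hc h'
  have hb0 : 0 < 2 * b := Real.sqrt_pos.mp hp0
  have hpsq : p ^ 2 = 2 * b := Real.sq_sqrt hb0.le
  have hps : p ≤ s + C := by
    rw [hp, Real.sqrt_le_left (by linarith)]; linarith
  set q := max (√(2 * a)) c with hq
  have hqc : c ≤ q := le_max_right _ _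
  have hqp : q ≤ p := max_le (Real.sqrt_le_sqrt (by linarith)) h'.le
  have hqsq : 2 * a ≤ q ^ 2 := by
    have h1 : 2 * a ≤ √(2 * a) ^ 2 := by
      rcases le_or_gt 0 (2 * a) with h2 | h2
      · rw [Real.sq_sqrt h2]
      · nlinarith [sq_nonneg (√(2 * a))]
    have h2 : √(2 * a) ≤ q := le_max_left _ _
    have h3 : 0 ≤ √(2 * a) := Real.sqrt_nonneg _
    nlinarith
  have e1 : levelGain c b = (p - c) ^ 2 / 2 := by
    unfold levelGain; rw [max_eq_left (by linarith)]
  have e2 : levelGain c a = (q - c) ^ 2 / 2 := by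
    unfold levelGain
    congr 2
    rcases le_total (√(2 * a)) c with h2 | h2
    · rw [hq, max_eq_right h2, max_eq_right (by linarith)]; ring
    · rw [hq, max_eq_left h2, max_eq_left (by linarith)]
  rw [e1, e2]
  have hδ : p ^ 2 - q ^ 2 ≤ 2 * s := by linarith
  have k1 : p * ((p - c) ^ 2 / 2 - (q - c) ^ 2 / 2) ≤ (p ^ 2 - q ^ 2) / 2 * (p - c) := by
    nlinarith [mul_nonneg hc (sq_nonneg (p - q))]
  have k2 : (p ^ 2 - q ^ 2) / 2 * (p - c) ≤ s * (p - c) := by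
    apply mul_le_mul_of_nonneg_right _ (by linarith); linarith
  have k3 : s * (p - c) ≤ p * (s - c + C) := by
    nlinarith [mul_le_mul_of_nonneg_left hps hc, mul_le_mul_of_nonneg_left h'.le hC]
  exact le_of_mul_le_mul_left (by linarith) hp0

theorem levelGain_sub_le {a b c : ℝ} (hc : 0 ≤ c) (ha : 0 ≤ a) (hab : a ≤ b) :
    levelGain c b - levelGain c a ≤ b - a := by
  have h1 : √(2 * a) ^ 2 = 2 * a := Real.sq_sqrt (by linarith)
  have h2 : √(2 * b) ^ 2 = 2 * b := Real.sq_sqrt (by linarith)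
  have h3 : √(2 * a) ≤ √(2 * b) := Real.sqrt_le_sqrt (by linarith)
  have h4 : 0 ≤ √(2 * a) := Real.sqrt_nonneg _
  unfold levelGain
  rcases le_total (√(2 * a)) c with h5 | h5 <;> rcases le_total (√(2 * b)) c with h6 | h6
  · rw [max_eq_right (by linarith), max_eq_right (by linarith)]; linarith
  · rw [max_eq_left (by linarith), max_eq_right (by linarith)]; nlinarith
  · rw [max_eq_right (by linarith), max_eq_left (by linarith)]; nlinarith
  · rw [max_eq_left (by linarith), max_eq_left (by linarith)]; nlinarith

/-- Walking from a slab mostly filled by a set to one mostly avoiding it, the potential is paid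
for by the cops met on the way. -/
theorem levelGain_chain {s d : ℕ → ℝ} {n C u w : ℝ} (hC : 0 ≤ C) (hu : 0 ≤ u)
    (hw : 0 ≤ w) (hwn : w ≤ n) (m : ℕ)
    (hd0 : ∀ j ≤ m, 0 ≤ d j) (hd1 : ∀ j ≤ m, d j ≤ n ^ 2)
    (hstep : ∀ j < m, d j ≤ d (j + 1) + s (j + 1))
    (hus : ∀ j ≤ m, u ≤ s j) (hws : ∀ j ≤ m, d j ≤ n ^ 2 / 2 → w ≤ s j)
    (hslice : ∀ j ≤ m, d j ≤ (s j + C) ^ 2 / 2 ∨ n ^ 2 - d j ≤ (s j + C) ^ 2 / 2)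
    (h0 : n ^ 2 / 2 < d 0) :
    (n ^ 2 / 2 < d m ∧ levelGain u (n ^ 2 - d m) - levelGain u (n ^ 2 - d 0) ≤
      ∑ j ∈ range m, (s (j + 1) - (if n ^ 2 / 2 < d (j + 1) then u else w) + (C + 1))) ∨
    (levelGain u (n ^ 2 / 2) - levelGain u (n ^ 2 - d 0) + levelGain w (n ^ 2 / 2)
        - levelGain w (min (d m) (n ^ 2 / 2)) ≤
      ∑ j ∈ range m, (s (j + 1) - (if n ^ 2 / 2 < d (j + 1) then u else w) + (C + 1)) + n) := by
  induction m with
  | zero => left; simpa using h0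
  | succ m ih =>
    have ih := ih (fun j hj => hd0 j (by omega)) (fun j hj => hd1 j (by omega))
      (fun j hj => hstep j (by omega)) (fun j hj => hus j (by omega))
      (fun j hj => hws j (by omega)) (fun j hj => hslice j (by omega))
    rw [sum_range_succ]
    have st := hstep m (by omega)
    have us := hus (m + 1) le_rfl
    have sl := hslice (m + 1) le_rfl
    have p0 := hd0 (m + 1) le_rfl
    have p1 := hd1 (m + 1) le_rfl
    have q1 := hd1 m (by omega)
    have s0 : 0 ≤ s (m + 1) := hu.trans us
    rcases lt_or_ge (n ^ 2 / 2) (d (m + 1)) with hH | hR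
    · rw [if_pos hH]
      rcases ih with ⟨_, ih⟩ | ih
      · left
        refine ⟨hH, ?_⟩
        have hs : n ^ 2 - d (m + 1) ≤ (s (m + 1) + C) ^ 2 / 2 := by
          rcases sl with h | h <;> linarith
        have := levelGain_step (a := n ^ 2 - d m) (b := n ^ 2 - d (m + 1)) (C := C + 1) hu us
          (by linarith) (by linarith) (by nlinarith)
        linarith
      · right
        rw [min_eq_right hH.le]
        have := levelGain_mono w (min_le_right (d m) (n ^ 2 / 2))
        linarith
    · rw [if_neg (not_lt.mpr hR), min_eq_left hR]
      have ws := hws (m + 1) le_rfl hR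
      right
      rcases ih with ⟨hm, ih⟩ | ih
      · have e1 := levelGain_sub_le (a := n ^ 2 - d m) (b := n ^ 2 / 2) hu
          (by linarith) (by linarith)
        have e2 := levelGain_sub_le (a := d (m + 1)) (b := n ^ 2 / 2) hw p0 hR
        linarith
      · have hs : d (m + 1) ≤ (s (m + 1) + C) ^ 2 / 2 := by
          rcases sl with h | h <;> linarith
        have hmin : min (d m) (n ^ 2 / 2) ≤ d (m + 1) + s (m + 1) :=
          (min_le_left _ _).trans st
        have := levelGain_step (a := d (m + 1)) (b := min (d m) (n ^ 2 / 2)) (C := C + 1) hw ws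
          (by linarith) hmin (by nlinarith)
        linarith

theorem sum_lower_bound {N : ℕ} {s d : ℕ → ℝ} {n C u : ℝ} (hC : 0 ≤ C) (hu : 0 ≤ u)
    (hun : u ≤ n) (hus : ∀ i < N, u ≤ s i) (hd0 : ∀ i < N, 0 ≤ d i) (hd1 : ∀ i < N, d i ≤ n ^ 2)
    (hup : ∀ i, i + 1 < N → d i ≤ d (i + 1) + s (i + 1))
    (hdown : ∀ i, i + 1 < N → d (i + 1) ≤ d i + s i)
    (hslice : ∀ i < N, d i ≤ (s i + C) ^ 2 / 2 ∨ n ^ 2 - d i ≤ (s i + C) ^ 2 / 2)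
    {i₀ : ℕ} (hi₀ : i₀ < N) (h₀ : n ^ 2 - d i₀ ≤ (u + C) ^ 2 / 2) (hH₀ : n ^ 2 / 2 < d i₀)
    (hcard : 2 * #{i ∈ range N | n ^ 2 / 2 < d i} ≤ N) :
    ∃ w, u ≤ w ∧ w ≤ n ∧ (u + w) * N / 2 + ((n - u) ^ 2 + (n - w) ^ 2) / 2 ≤
      ∑ i ∈ range N, s i + (C + 1) * N + n + C ^ 2 := by
  have hn : 0 ≤ n := hu.trans hun
  set R := {i ∈ range N | ¬ n ^ 2 / 2 < d i} with hR
  set H := {i ∈ range N | n ^ 2 / 2 < d i} with hHdef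
  have hHR : #H + #R = N := by
    rw [hHdef, hR, card_filter_add_card_filter_not, card_range]
  have hRne : R.Nonempty := by
    rw [← card_pos]; omega
  obtain ⟨i₁, hi₁, hmin⟩ := exists_min_image R s hRne
  rw [hR, mem_filter, mem_range, not_lt] at hi₁
  obtain ⟨hi₁, hdi₁⟩ := hi₁
  set w := min n (s i₁) with hw
  have huw : u ≤ w := le_min hun (hus _ hi₁)
  have hw0 : 0 ≤ w := hu.trans huw
  have hwn : w ≤ n := min_le_left _ _
  have hws : ∀ i < N, d i ≤ n ^ 2 / 2 → w ≤ s i := fun i hi hd =>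
    (min_le_right _ _).trans (hmin i (by rw [hR, mem_filter, mem_range, not_lt]; exact ⟨hi, hd⟩))
  refine ⟨w, huw, hwn, ?_⟩
  set F : ℕ → ℝ := fun i => s i - (if n ^ 2 / 2 < d i then u else w) + (C + 1) with hF
  have hF0 : ∀ i < N, 0 ≤ F i := by
    intro i hi
    simp only [hF]
    split_ifs with h
    · linarith [hus i hi]
    · linarith [hws i hi (not_lt.mp h)]
  -- an injective walk from `i₀` to `i₁`
  obtain ⟨e, m, he0, hem, heN, hinj, hst⟩ : ∃ (e : ℕ → ℕ) (m : ℕ), e 0 = i₀ ∧ e m = i₁ ∧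
      (∀ j ≤ m, e j < N) ∧ (∀ j ≤ m, ∀ k ≤ m, e j = e k → j = k) ∧
      ∀ j < m, d (e j) ≤ d (e (j + 1)) + s (e (j + 1)) := by
    rcases le_total i₀ i₁ with h | h
    · refine ⟨fun j => i₀ + j, i₁ - i₀, rfl, by simp; omega, fun j hj => by simp; omega,
        fun j _ k _ h => by simpa using h, fun j hj => hup (i₀ + j) (by omega)⟩
    · refine ⟨fun j => i₀ - j, i₀ - i₁, rfl, by simp; omega, fun j hj => by simp; omega,
        fun j _ k _ h => by simp at h; omega, fun j hj => ?_⟩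
      have := hdown (i₀ - (j + 1)) (by omega)
      rwa [show i₀ - (j + 1) + 1 = i₀ - j by omega] at this
  have chain := levelGain_chain (s := s ∘ e) (d := d ∘ e) (n := n) (C := C) (u := u) (w := w)
    hC hu hw0 hwn m (fun j hj => hd0 _ (heN j hj)) (fun j hj => hd1 _ (heN j hj))
    hst (fun j hj => hus _ (heN j hj)) (fun j hj => hws _ (heN j hj))
    (fun j hj => hslice _ (heN j hj)) (by simpa [he0] using hH₀)
  have hsum : ∑ j ∈ range m, F (e (j + 1)) ≤ ∑ i ∈ range N, F i := by
    rw [← sum_image (s := range m) (g := fun j => e (j + 1)) (f := F)]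
    · apply sum_le_sum_of_subset_of_nonneg
      · intro i hi
        obtain ⟨j, hj, rfl⟩ := mem_image.mp hi
        exact mem_range.mpr (heN _ (by have := mem_range.mp hj; omega))
      · intro i hi _
        exact hF0 i (mem_range.mp hi)
    · intro j hj k hk h
      have hj := mem_range.mp hj
      have hk := mem_range.mp hk
      have := hinj (j + 1) (by omega) (k + 1) (by omega) h
      omega
  simp only [Function.comp, he0, hem] at chain
  rcases chain with ⟨h, _⟩ | chain
  · linarith
  rw [levelGain_half_sq hn hun, levelGain_half_sq hn hwn, min_eq_left hdi₁] at chain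
  have g1 : levelGain u (n ^ 2 - d i₀) ≤ C ^ 2 / 2 := levelGain_le hu hC h₀
  have g2 : levelGain w (d i₁) ≤ C ^ 2 / 2 := by
    apply levelGain_le hw0 hC
    rcases min_choice n (s i₁) with h | h
    · rw [hw, h]; nlinarith
    · rw [hw, h]
      rcases hslice i₁ hi₁ with h | h <;> linarith
  have hFs : ∑ i ∈ range N, F i = ∑ i ∈ range N, s i - (u * #H + w * #R) + (C + 1) * N := by
    simp only [hF, sum_add_distrib, sum_sub_distrib, sum_ite, sum_const, nsmul_eq_mul, card_range]
    ring
  have hκ : (u + w) * N / 2 ≤ u * #H + w * #R := by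
    have h1 : (#H : ℝ) + #R = N := by exact_mod_cast hHR
    have h2 : 2 * (#H : ℝ) ≤ N := by exact_mod_cast hcard
    nlinarith
  have : ∑ j ∈ range m, (s (e (j + 1)) - (if n ^ 2 / 2 < d (e (j + 1)) then u else w) + (C + 1))
    = ∑ j ∈ range m, F (e (j + 1)) := rfl
  linarith

/-- The counting behind the isoperimetric inequality in the square grid: `u i` vertices of a set
and `s i` vertices of its separator lie in row `i`, and row `i₀` avoids the set. -/
theorem two_mul_sum_le_sq {n : ℕ} {u s : ℕ → ℕ} (hup : ∀ i, i + 1 < n → u i ≤ u (i + 1) + s (i + 1))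
    (hdown : ∀ i, i + 1 < n → u (i + 1) ≤ u i + s i) (hpos : ∀ i < n, 0 < u i → 0 < s i)
    {i₀ : ℕ} (hi₀ : i₀ < n) (h₀ : u i₀ = 0) :
    2 * ∑ i ∈ range n, u i ≤ (∑ i ∈ range n, s i) ^ 2 := by
  set T := ∑ i ∈ range n, s i with hT
  have key : ∀ v, 0 < v → {i ∈ range n | v ≤ u i}.Nonempty → #{i ∈ range n | v ≤ u i} + v ≤ T := by
    intro v hv hne
    -- rows outside the level set carry at least `v` vertices of the separator
    have out : v ≤ ∑ i ∈ range n with ¬ v ≤ u i, s i := by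
      obtain ⟨j, hj⟩ := hne
      rw [mem_filter, mem_range] at hj
      rcases le_total i₀ j with h | h
      · have hex : ∃ t, i₀ + t < n ∧ v ≤ u (i₀ + t) := ⟨j - i₀, by
          rw [show i₀ + (j - i₀) = j by omega]; exact hj⟩
        classical
        set t := Nat.find hex with ht
        have ht1 := Nat.find_spec hex
        rw [← ht] at ht1
        have tel : ∀ r, r ≤ t → u (i₀ + r) ≤ ∑ i ∈ range r, s (i₀ + i) := by
          intro r
          induction r with
          | zero => intro _; simp [h₀]
          | succ r ih =>
            intro hr
            rw [sum_range_succ]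
            have := hdown (i₀ + r) (by omega)
            have := ih (by omega)
            rw [← add_assoc]
            omega
        refine ht1.2.trans ((tel t le_rfl).trans ?_)
        rw [← sum_image (s := range t) (g := fun i => i₀ + i) (f := s)
          (fun a _ b _ h => by simpa using h)]
        apply sum_le_sum_of_subset
        intro i hi
        obtain ⟨r, hr, rfl⟩ := mem_image.mp hi
        have hr := mem_range.mp hr
        have := Nat.find_min hex hr
        rw [mem_filter, mem_range]
        refine ⟨by omega, fun h => this ⟨by omega, h⟩⟩
      · have hex : ∃ t, t ≤ i₀ ∧ v ≤ u (i₀ - t) := ⟨i₀ - j, by omega, by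
          rw [show i₀ - (i₀ - j) = j by omega]; exact hj.2⟩
        classical
        set t := Nat.find hex with ht
        have ht1 := Nat.find_spec hex
        rw [← ht] at ht1
        have tel : ∀ r, r ≤ t → u (i₀ - r) ≤ ∑ i ∈ range r, s (i₀ - i) := by
          intro r
          induction r with
          | zero => intro _; simp [h₀]
          | succ r ih =>
            intro hr
            rw [sum_range_succ]
            have h1 := hup (i₀ - (r + 1)) (by omega)
            rw [show i₀ - (r + 1) + 1 = i₀ - r by omega] at h1
            have := ih (by omega)
            omega
        refine ht1.2.trans ((tel t le_rfl).trans ?_)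
        rw [← sum_image (s := range t) (g := fun i => i₀ - i) (f := s)
          (fun a ha b hb h => by
            have ha := mem_range.mp ha
            have hb := mem_range.mp hb
            simp only at h
            omega)]
        apply sum_le_sum_of_subset
        intro i hi
        obtain ⟨r, hr, rfl⟩ := mem_image.mp hi
        have hr := mem_range.mp hr
        have := Nat.find_min hex hr
        rw [mem_filter, mem_range]
        refine ⟨by omega, fun h => this ⟨by omega, h⟩⟩
    have inn : #{i ∈ range n | v ≤ u i} ≤ ∑ i ∈ range n with v ≤ u i, s i := by
      rw [card_eq_sum_ones]
      apply sum_le_sum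
      intro i hi
      rw [mem_filter, mem_range] at hi
      exact hpos i hi.1 (by omega)
    have := sum_filter_add_sum_filter_not (range n) (fun i => v ≤ u i) s
    omega
  have hle : ∀ i < n, u i ≤ T := by
    intro i hi
    rcases Nat.eq_zero_or_pos (u i) with h | h
    · omega
    · have := key (u i) h ⟨i, by simp [hi]⟩
      omega
  have layer : ∑ i ∈ range n, u i = ∑ v ∈ range T, #{i ∈ range n | v + 1 ≤ u i} := by
    simp_rw [card_filter]
    rw [sum_comm]
    apply sum_congr rfl
    intro i hi
    rw [← card_filter]
    have : {v ∈ range T | v + 1 ≤ u i} = range (u i) := by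
      ext v
      have := hle i (mem_range.mp hi)
      simp only [mem_filter, mem_range]
      omega
    rw [this, card_range]
  have hb : ∀ v ∈ range T, #{i ∈ range n | v + 1 ≤ u i} ≤ T - 1 - v := by
    intro v hv
    rcases (#{i ∈ range n | v + 1 ≤ u i}).eq_zero_or_pos with h | h
    · omega
    · have := key (v + 1) (by omega) (card_pos.mp h)
      omega
  have h1 : ∑ i ∈ range n, u i ≤ ∑ v ∈ range T, v := by
    rw [layer, ← sum_range_reflect (fun v => v) T]
    exact sum_le_sum hb
  have h2 := Finset.sum_range_id_mul_two T
  have h3 : T * (T - 1) ≤ T ^ 2 := by rw [sq]; exact Nat.mul_le_mul_left _ (Nat.sub_le _ _)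
  omega

/-- Values of a slowly varying sequence in a window differ by at most the total variation bound. -/
theorem le_add_sum_window {n i b : ℕ} {s d : ℕ → ℕ}
    (hup : ∀ z, z + 1 < n → d z ≤ d (z + 1) + s (z + 1))
    (hdown : ∀ z, z + 1 < n → d (z + 1) ≤ d z + s z) (hib : i + b ≤ n) {y z : ℕ}
    (hy : y ∈ Ico i (i + b)) (hz : z ∈ Ico i (i + b)) :
    d y ≤ d z + ∑ q ∈ Ico i (i + b), s q := by
  rw [mem_Ico] at hy hz
  have up : ∀ a t, a + t < n → d a ≤ d (a + t) + ∑ q ∈ Ico (a + 1) (a + t + 1), s q := by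
    intro a t
    induction t with
    | zero => intro _; simp
    | succ t ih =>
      intro h
      have h1 := ih (by omega)
      have h2 := hup (a + t) (by omega)
      rw [sum_Ico_succ_top (by omega), show a + (t + 1) = a + t + 1 by omega]
      omega
  have down : ∀ a t, a + t < n → d (a + t) ≤ d a + ∑ q ∈ Ico a (a + t), s q := by
    intro a t
    induction t with
    | zero => intro _; simp
    | succ t ih =>
      intro h
      have h1 := ih (by omega)
      have h2 := hdown (a + t) (by omega)
      rw [show a + (t + 1) = a + t + 1 by omega, sum_Ico_succ_top (by omega)]
      omega
  rcases le_total y z with h | h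
  · have h1 := up y (z - y) (by omega)
    rw [show y + (z - y) = z by omega] at h1
    refine h1.trans (Nat.add_le_add_left (sum_le_sum_of_subset ?_) _)
    intro q hq
    rw [mem_Ico] at hq ⊢
    omega
  · have h1 := down z (y - z) (by omega)
    rw [show z + (y - z) = y by omega] at h1
    refine h1.trans (Nat.add_le_add_left (sum_le_sum_of_subset ?_) _)
    intro q hq
    rw [mem_Ico] at hq ⊢
    omega

/-- The average of a sequence over the window of length `b` that starts at `i`. -/
noncomputable def windowAverage (b : ℕ) (d : ℕ → ℕ) (i : ℕ) : ℝ :=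
  (∑ q ∈ Ico i (i + b), (d q : ℝ)) / b

theorem windowAverage_le {b i : ℕ} (hb : 0 < b) {d : ℕ → ℕ} {M : ℝ}
    (h : ∀ q ∈ Ico i (i + b), (d q : ℝ) ≤ M) : windowAverage b d i ≤ M := by
  have hb' : (0 : ℝ) < b := by exact_mod_cast hb
  rw [windowAverage, div_le_iff₀ hb']
  refine (sum_le_card_nsmul _ _ _ h).trans ?_
  simp [mul_comm]

theorem le_windowAverage {b i : ℕ} (hb : 0 < b) {d : ℕ → ℕ} {M : ℝ}
    (h : ∀ q ∈ Ico i (i + b), M ≤ (d q : ℝ)) : M ≤ windowAverage b d i := by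
  have hb' : (0 : ℝ) < b := by exact_mod_cast hb
  rw [windowAverage, le_div_iff₀ hb']
  refine le_trans ?_ (card_nsmul_le_sum _ _ _ h)
  simp [mul_comm]

theorem windowAverage_succ (b i : ℕ) (d : ℕ → ℕ) :
    windowAverage b d (i + 1) = windowAverage b (fun q => d (q + 1)) i := by
  unfold windowAverage
  rw [sum_Ico_add' (fun q => (d q : ℝ)) i (i + b) 1]
  congr 3
  omega

theorem windowAverage_add (b i : ℕ) (d s : ℕ → ℕ) :
    windowAverage b (fun q => d q + s q) i = windowAverage b d i + windowAverage b s i := by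
  unfold windowAverage
  rw [← add_div, ← sum_add_distrib]
  push_cast
  rfl

theorem windowAverage_mono {b i : ℕ} {d e : ℕ → ℕ} (h : ∀ q ∈ Ico i (i + b), d q ≤ e q) :
    windowAverage b d i ≤ windowAverage b e i := by
  unfold windowAverage
  gcongr with q hq
  exact h q hq

theorem window_slice_bound {n i b F : ℕ} (hb : 0 < b) {s d : ℕ → ℕ}
    (hup : ∀ z, z + 1 < n → d z ≤ d (z + 1) + s (z + 1))
    (hdown : ∀ z, z + 1 < n → d (z + 1) ≤ d z + s z) (hib : i + b ≤ n)
    (hF : ∑ q ∈ Ico i (i + b), s q ≤ F) {z : ℕ} (hz : z ∈ Ico i (i + b))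
    (hsz : b * s z ≤ F) :
    ((d z : ℝ) ≤ (s z + 1) ^ 2 / 2 →
      windowAverage b d i ≤ ((F : ℝ) / b + (b + 1)) ^ 2 / 2) ∧
    (((n : ℝ) ^ 2 - d z ≤ (s z + 1) ^ 2 / 2) →
      (n : ℝ) ^ 2 - windowAverage b d i ≤ ((F : ℝ) / b + (b + 1)) ^ 2 / 2) := by
  have hb' : (0 : ℝ) < b := by exact_mod_cast hb
  have hs : (s z : ℝ) ≤ F / b := by
    rw [le_div_iff₀' hb']; exact_mod_cast hsz
  have hs0 : (0 : ℝ) ≤ s z := by positivity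
  have hFb : (F : ℝ) = b * (F / b) := by field_simp
  set f := (F : ℝ) / b with hf
  have h1 : windowAverage b d i ≤ d z + F := windowAverage_le hb fun q hq => by
    have := le_add_sum_window hup hdown hib hq hz
    exact_mod_cast this.trans (by omega)
  have h2 : (d z : ℝ) - F ≤ windowAverage b d i := le_windowAverage hb fun q hq => by
    have := le_add_sum_window hup hdown hib hz hq
    have : d z ≤ d q + F := this.trans (by omega)
    have : (d z : ℝ) ≤ d q + F := by exact_mod_cast this
    linarith
  have h3 : ((s z : ℝ) + 1) ^ 2 / 2 + F ≤ (f + (b + 1)) ^ 2 / 2 := by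
    rw [hFb]
    nlinarith [mul_nonneg hs0 hb'.le]
  exact ⟨fun h => by linarith, fun h => by linarith⟩

/-- Each point lies in at most `b + 2` of the windows of length `b`, enlarged by one unit at
each end. -/
theorem sum_card_window_le {ι : Type*} (J : Finset ι) (f : ι → ℕ) (N b : ℕ) :
    ∑ i ∈ range N, #{j ∈ J | i ≤ f j + 1 ∧ f j ≤ i + b} ≤ (b + 2) * #J := by
  simp_rw [card_filter]
  rw [sum_comm, mul_comm, ← smul_eq_mul]
  refine sum_le_card_nsmul _ _ _ fun j _ => ?_
  rw [← card_filter]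
  have : {i ∈ range N | i ≤ f j + 1 ∧ f j ≤ i + b} ⊆ Icc (f j - b) (f j + 1) := by
    intro i hi
    rw [mem_filter] at hi
    rw [mem_Icc]
    omega
  refine (card_le_card this).trans ?_
  rw [Nat.card_Icc]
  omega

theorem exists_window_min {ι : Type*} (J : Finset ι) (f : ι → ℕ) {N : ℕ} (b : ℕ) (hN : 0 < N) :
    ∃ i < N, (∀ i' < N, #{j ∈ J | i ≤ f j + 1 ∧ f j ≤ i + b} ≤
        #{j ∈ J | i' ≤ f j + 1 ∧ f j ≤ i' + b}) ∧
      N * #{j ∈ J | i ≤ f j + 1 ∧ f j ≤ i + b} ≤ (b + 2) * #J := by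
  obtain ⟨i, hi, hmin⟩ := exists_min_image (range N)
    (fun i => #{j ∈ J | i ≤ f j + 1 ∧ f j ≤ i + b}) ⟨0, mem_range.mpr hN⟩
  refine ⟨i, mem_range.mp hi, fun i' hi' => hmin i' (mem_range.mpr hi'), ?_⟩
  refine le_trans ?_ (sum_card_window_le J f N b)
  have := card_nsmul_le_sum _ _ _ hmin
  simpa using this

theorem exists_lt_notMem_image {ι : Type*} {J : Finset ι} {n : ℕ} (f : ι → ℕ) (h : #J < n) :
    ∃ x < n, ∀ j ∈ J, f j ≠ x := by
  classical
  obtain ⟨x, hx, hx'⟩ := exists_mem_notMem_of_card_lt_card (s := J.image f) (t := range n)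
    (by rw [card_range]; exact card_image_le.trans_lt h)
  exact ⟨x, mem_range.mp hx, fun j hj hjx => hx' (mem_image.mpr ⟨j, hj, hjx⟩)⟩

theorem card_filter_le_add {ι : Type*} {n : ℕ} {A B : ℕ → Prop} [DecidablePred A]
    [DecidablePred B] {J : Finset ι} (f : ι → ℕ)
    (h : ∀ x < n, A x → B x ∨ ∃ j ∈ J, f j = x) :
    #{x ∈ range n | A x} ≤ #{x ∈ range n | B x} + #J := by
  classical
  have : {x ∈ range n | A x} ⊆ {x ∈ range n | B x} ∪ J.image f := by
    intro x hx
    rw [mem_filter, mem_range] at hx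
    rw [mem_union, mem_filter, mem_range, mem_image]
    rcases h x hx.1 hx.2 with h | h
    · exact Or.inl ⟨hx.1, h⟩
    · exact Or.inr h
  exact (card_le_card this).trans ((card_union_le _ _).trans
    (Nat.add_le_add_left card_image_le _))

theorem iff_of_iff_succ {P : ℕ → Prop} {a b : ℕ}
    (h : ∀ i, a ≤ i → i + 1 < b → (P i ↔ P (i + 1))) {i j : ℕ} (hi : a ≤ i) (hib : i < b)
    (hj : a ≤ j) (hjb : j < b) : P i ↔ P j := by
  have key : ∀ t, a + t < b → (P a ↔ P (a + t)) := by
    intro t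
    induction t with
    | zero => intro _; rfl
    | succ t ih => intro ht; exact (ih (by omega)).trans (h (a + t) (by omega) ht)
  have h1 := key (i - a) (by omega)
  have h2 := key (j - a) (by omega)
  rw [show a + (i - a) = i by omega] at h1
  rw [show a + (j - a) = j by omega] at h2
  exact h1.symm.trans h2

/-- The set `D` of cells of the `n × n × n` grid is a union of components of the complement
of `S`. -/
structure ClosedOff (n : ℕ) (S D : ℕ → ℕ → ℕ → Prop) : Prop where
  disj : ∀ z y x, D z y x → ¬ S z y x
  stepZ : ∀ z y x, z + 1 < n → y < n → x < n → ¬ S z y x → ¬ S (z + 1) y x →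
    (D z y x ↔ D (z + 1) y x)
  stepY : ∀ z y x, z < n → y + 1 < n → x < n → ¬ S z y x → ¬ S z (y + 1) x →
    (D z y x ↔ D z (y + 1) x)
  stepX : ∀ z y x, z < n → y < n → x + 1 < n → ¬ S z y x → ¬ S z y (x + 1) →
    (D z y x ↔ D z y (x + 1))

theorem ClosedOff.compl {n : ℕ} {S D : ℕ → ℕ → ℕ → Prop} (h : ClosedOff n S D) :
    ClosedOff n S (fun z y x => ¬ D z y x ∧ ¬ S z y x) where
  disj _ _ _ h := h.2
  stepZ z y x hz hy hx h1 h2 := by simp only [h.stepZ z y x hz hy hx h1 h2, h1, h2]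
  stepY z y x hz hy hx h1 h2 := by simp only [h.stepY z y x hz hy hx h1 h2, h1, h2]
  stepX z y x hz hy hx h1 h2 := by simp only [h.stepX z y x hz hy hx h1 h2, h1, h2]

section Cells

variable {ι : Type*} (cz cy cx : ι → ℕ)

/-- Some cop stands on the given cell. -/
def Occ (z y x : ℕ) : Prop := ∃ j, cz j = z ∧ cy j = y ∧ cx j = x

variable {cz cy cx} {n : ℕ} {D : ℕ → ℕ → ℕ → Prop}

theorem ClosedOff.lineZ (h : ClosedOff n (Occ cz cy cx) D) {a b y x : ℕ} (hb : b ≤ n) (hy : y < n)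
    (hx : x < n) (hS : ∀ z, a ≤ z → z < b → ¬ Occ cz cy cx z y x) {z z' : ℕ} (hz : a ≤ z)
    (hzb : z < b) (hz' : a ≤ z') (hzb' : z' < b) : D z y x ↔ D z' y x :=
  iff_of_iff_succ (P := fun z => D z y x) (fun i hi hib => h.stepZ i y x (by omega) hy hx
    (hS i hi (by omega)) (hS (i + 1) (by omega) hib)) hz hzb hz' hzb'

theorem ClosedOff.lineY (h : ClosedOff n (Occ cz cy cx) D) {a b z x : ℕ} (hb : b ≤ n) (hz : z < n)
    (hx : x < n) (hS : ∀ y, a ≤ y → y < b → ¬ Occ cz cy cx z y x) {y y' : ℕ} (hy : a ≤ y)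
    (hyb : y < b) (hy' : a ≤ y') (hyb' : y' < b) : D z y x ↔ D z y' x :=
  iff_of_iff_succ (P := fun y => D z y x) (fun i hi hib => h.stepY z i x hz (by omega) hx
    (hS i hi (by omega)) (hS (i + 1) (by omega) hib)) hy hyb hy' hyb'

theorem ClosedOff.lineX (h : ClosedOff n (Occ cz cy cx) D) {z y : ℕ} (hz : z < n)
    (hy : y < n) (hS : ∀ x < n, ¬ Occ cz cy cx z y x) {x x' : ℕ} (hx : x < n) (hx' : x' < n) :
    D z y x ↔ D z y x' :=
  iff_of_iff_succ (P := fun x => D z y x) (a := 0) (b := n)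
    (fun i _ hib => h.stepX z y i hz hy hib (hS i (by omega)) (hS (i + 1) hib))
    (Nat.zero_le _) hx (Nat.zero_le _) hx'

variable [Fintype ι]

open Classical in
/-- The number of cells of `D` in the plane at height `z`. -/
noncomputable def planeCard (n : ℕ) (D : ℕ → ℕ → ℕ → Prop) (z : ℕ) : ℕ :=
  ∑ y ∈ range n, #{x ∈ range n | D z y x}

variable (cz) in
/-- The number of cops in the plane at height `z`. -/
def copCard (z : ℕ) : ℕ := #{j | cz j = z}

theorem sum_row_le_copCard (z : ℕ) :
    ∑ y ∈ range n, #{j | cz j = z ∧ cy j = y} ≤ copCard cz z := by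
  simp_rw [card_filter, ite_and]
  rw [sum_comm, copCard, card_filter]
  refine sum_le_sum fun j _ => ?_
  split_ifs
  · rw [sum_ite_eq]; split_ifs <;> omega
  · simp

theorem ClosedOff.planeCard_le_succ (h : ClosedOff n (Occ cz cy cx) D) {z : ℕ} (hz : z + 1 < n) :
    planeCard n D z ≤ planeCard n D (z + 1) + copCard cz (z + 1) := by
  classical
  refine le_trans ?_ (Nat.add_le_add_left (sum_row_le_copCard (cy := cy) (n := n) (z + 1)) _)
  rw [planeCard, planeCard, ← sum_add_distrib]
  refine sum_le_sum fun y hy => card_filter_le_add cx fun x hx hD => ?_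
  by_cases hS : Occ cz cy cx (z + 1) y x
  · obtain ⟨j, h1, h2, h3⟩ := hS
    exact Or.inr ⟨j, by simp [h1, h2], h3⟩
  · exact Or.inl ((h.stepZ z y x hz (mem_range.mp hy) hx (h.disj _ _ _ hD) hS).mp hD)

theorem ClosedOff.planeCard_succ_le (h : ClosedOff n (Occ cz cy cx) D) {z : ℕ} (hz : z + 1 < n) :
    planeCard n D (z + 1) ≤ planeCard n D z + copCard cz z := by
  classical
  refine le_trans ?_ (Nat.add_le_add_left (sum_row_le_copCard (cy := cy) (n := n) z) _)
  rw [planeCard, planeCard, ← sum_add_distrib]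
  refine sum_le_sum fun y hy => card_filter_le_add cx fun x hx hD => ?_
  by_cases hS : Occ cz cy cx z y x
  · obtain ⟨j, h1, h2, h3⟩ := hS
    exact Or.inr ⟨j, by simp [h1, h2], h3⟩
  · exact Or.inl ((h.stepZ z y x hz (mem_range.mp hy) hx hS (h.disj _ _ _ hD)).mpr hD)

/-- The isoperimetric inequality in a plane: a set of cells cut off by `s` cops that avoids the
crossing of a free row and a free column has at most `s² / 2` elements. -/
theorem ClosedOff.two_mul_planeCard_le (h : ClosedOff n (Occ cz cy cx) D) {z y₀ x₀ : ℕ}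
    (hz : z < n) (hy₀ : y₀ < n) (hx₀ : x₀ < n) (hrow : ∀ x < n, ¬ Occ cz cy cx z y₀ x)
    (hcol : ∀ y < n, ¬ Occ cz cy cx z y x₀) (h₀ : ¬ D z y₀ x₀) :
    2 * planeCard n D z ≤ copCard cz z ^ 2 := by
  classical
  refine le_trans ?_ (Nat.pow_le_pow_left (sum_row_le_copCard (cy := cy) (n := n) z) 2)
  have free : ∀ y < n, (∀ x < n, ¬ Occ cz cy cx z y x) → #{x ∈ range n | D z y x} = 0 := by
    intro y hy hS
    rw [card_eq_zero, filter_eq_empty_iff]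
    intro x hx hD
    have h1 := (h.lineX hz hy hS (mem_range.mp hx) hx₀).mp hD
    exact h₀ ((h.lineY (a := 0) le_rfl hz hx₀ (fun y _ hy => hcol y hy) (Nat.zero_le _) hy
      (Nat.zero_le _) hy₀).mp h1)
  refine two_mul_sum_le_sq (u := fun y => #{x ∈ range n | D z y x})
    (s := fun y => #{j | cz j = z ∧ cy j = y}) ?_ ?_ ?_ hy₀ (free y₀ hy₀ hrow)
  · intro y hy
    refine card_filter_le_add cx fun x hx hD => ?_
    by_cases hS : Occ cz cy cx z (y + 1) x
    · obtain ⟨j, h1, h2, h3⟩ := hS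
      exact Or.inr ⟨j, by simp [h1, h2], h3⟩
    · exact Or.inl ((h.stepY z y x hz hy hx (h.disj _ _ _ hD) hS).mp hD)
  · intro y hy
    refine card_filter_le_add cx fun x hx hD => ?_
    by_cases hS : Occ cz cy cx z y x
    · obtain ⟨j, h1, h2, h3⟩ := hS
      exact Or.inr ⟨j, by simp [h1, h2], h3⟩
    · exact Or.inl ((h.stepY z y x hz hy hx hS (h.disj _ _ _ hD)).mpr hD)
  · intro y hy hpos
    by_contra hs
    refine hpos.ne' (free y hy fun x _ ⟨j, h1, h2, _⟩ => hs ?_)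
    exact card_pos.mpr ⟨j, by simp [h1, h2]⟩

theorem sq_le_planeCard_add (z : ℕ) :
    n ^ 2 ≤ planeCard n D z + planeCard n (fun z y x => ¬ D z y x ∧ ¬ Occ cz cy cx z y x) z +
      copCard cz z := by
  classical
  refine le_trans ?_ (Nat.add_le_add_left (sum_row_le_copCard (cy := cy) (n := n) z) _)
  rw [planeCard, planeCard, ← sum_add_distrib, ← sum_add_distrib]
  have : n ^ 2 = ∑ y ∈ range n, n := by simp [sq]
  rw [this]
  refine sum_le_sum fun y _ => ?_
  have h1 := card_filter_add_card_filter_not (s := range n) (fun x => D z y x)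
  rw [card_range] at h1
  have h2 := @card_filter_le_add ι n (fun x => ¬ D z y x)
    (fun x => ¬ D z y x ∧ ¬ Occ cz cy cx z y x) _ (fun _ => Classical.propDecidable _)
    ({j | cz j = z ∧ cy j = y} : Finset ι) cx (fun x _ hx => by
      by_cases hS : Occ cz cy cx z y x
      · obtain ⟨j, h1, h2, h3⟩ := hS
        exact Or.inr ⟨j, by simp [h1, h2], h3⟩
      · exact Or.inl ⟨hx, hS⟩)
  omega

theorem planeCard_le_sq (z : ℕ) : planeCard n D z ≤ n ^ 2 := by
  classical
  rw [planeCard, sq]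
  refine (sum_le_card_nsmul _ _ n fun y _ => ?_).trans (by simp)
  exact (card_filter_le _ _).trans (by simp)

theorem ClosedOff.sq_sub_planeCard_le (h : ClosedOff n (Occ cz cy cx) D) {z y₀ x₀ : ℕ}
    (hz : z < n) (hy₀ : y₀ < n) (hx₀ : x₀ < n) (hrow : ∀ x < n, ¬ Occ cz cy cx z y₀ x)
    (hcol : ∀ y < n, ¬ Occ cz cy cx z y x₀) (h₀ : D z y₀ x₀) :
    (n : ℝ) ^ 2 - planeCard n D z ≤ (copCard cz z + 1) ^ 2 / 2 := by
  have h1 := h.compl.two_mul_planeCard_le hz hy₀ hx₀ hrow hcol (fun h => h.1 h₀)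
  have h2 := sq_le_planeCard_add (cz := cz) (cy := cy) (cx := cx) (n := n) (D := D) z
  have h3 : 2 * n ^ 2 ≤ 2 * planeCard n D z + copCard cz z ^ 2 + 2 * copCard cz z := by omega
  have h4 : 2 * (n : ℝ) ^ 2 ≤ 2 * planeCard n D z + copCard cz z ^ 2 + 2 * copCard cz z := by
    exact_mod_cast h3
  nlinarith

theorem ClosedOff.planeCard_dichotomy (h : ClosedOff n (Occ cz cy cx) D) {z : ℕ} (hz : z < n) :
    (planeCard n D z : ℝ) ≤ (copCard cz z + 1) ^ 2 / 2 ∨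
      (n : ℝ) ^ 2 - planeCard n D z ≤ (copCard cz z + 1) ^ 2 / 2 := by
  rcases lt_or_ge (copCard cz z) n with hs | hs
  · obtain ⟨y₀, hy₀, hy⟩ := exists_lt_notMem_image cy hs
    obtain ⟨x₀, hx₀, hx⟩ := exists_lt_notMem_image cx hs
    have hrow : ∀ x < n, ¬ Occ cz cy cx z y₀ x := fun x _ ⟨j, h1, h2, _⟩ =>
      hy j (by simp [h1]) h2
    have hcol : ∀ y < n, ¬ Occ cz cy cx z y x₀ := fun y _ ⟨j, h1, _, h2⟩ =>
      hx j (by simp [h1]) h2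
    by_cases h₀ : D z y₀ x₀
    · exact Or.inr (h.sq_sub_planeCard_le hz hy₀ hx₀ hrow hcol h₀)
    · left
      have h1 := h.two_mul_planeCard_le hz hy₀ hx₀ hrow hcol h₀
      have h2 : 2 * (planeCard n D z : ℝ) ≤ copCard cz z ^ 2 := by exact_mod_cast h1
      have h3 : (0 : ℝ) ≤ copCard cz z := by positivity
      nlinarith
  · have hs' : (n : ℝ) ≤ copCard cz z := by exact_mod_cast hs
    have hn : (0 : ℝ) ≤ n := by positivity
    rcases le_total (planeCard n D z : ℝ) (n ^ 2 / 2) with h1 | h1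
    · left; nlinarith
    · right; nlinarith

theorem sum_copCard_window (i b : ℕ) :
    ∑ q ∈ Ico i (i + b), copCard cz q = #{j | i ≤ cz j ∧ cz j < i + b} := by
  have h := card_eq_sum_card_fiberwise (f := cz) (s := ({j | i ≤ cz j ∧ cz j < i + b} : Finset ι))
    (t := Ico i (i + b)) (fun j hj => by simpa using hj)
  rw [h]
  refine sum_congr rfl fun q hq => ?_
  rw [copCard, filter_filter]
  congr 1
  ext j
  simp only [mem_filter, mem_univ, true_and]
  rw [mem_Ico] at hq
  omega

end Cells

open Classical in
/-- In most slabs of thickness `100`, the set `D` fills more than half of the cells. -/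
def IsBig (n : ℕ) (D : ℕ → ℕ → ℕ → Prop) : Prop :=
  n + 1 - 100 < 2 * #{i ∈ range (n + 1 - 100) |
    (n : ℝ) ^ 2 / 2 < windowAverage 100 (planeCard n D) i}

theorem IsBig.exists_common {n : ℕ} {D E : ℕ → ℕ → ℕ → Prop} (hD : IsBig n D) (hE : IsBig n E) :
    ∃ z y x, D z y x ∧ E z y x := by
  classical
  by_contra! hne
  unfold IsBig at hD hE
  obtain ⟨i, hi⟩ : ({i ∈ range (n + 1 - 100) |
      (n : ℝ) ^ 2 / 2 < windowAverage 100 (planeCard n D) i} ∩ {i ∈ range (n + 1 - 100) |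
      (n : ℝ) ^ 2 / 2 < windowAverage 100 (planeCard n E) i}).Nonempty := by
    rw [← card_pos]
    have h1 := card_union_add_card_inter {i ∈ range (n + 1 - 100) |
      (n : ℝ) ^ 2 / 2 < windowAverage 100 (planeCard n D) i} {i ∈ range (n + 1 - 100) |
      (n : ℝ) ^ 2 / 2 < windowAverage 100 (planeCard n E) i}
    have h2 := card_le_card (union_subset
      (filter_subset (fun i => (n : ℝ) ^ 2 / 2 < windowAverage 100 (planeCard n D) i)
        (range (n + 1 - 100)))
      (filter_subset (fun i => (n : ℝ) ^ 2 / 2 < windowAverage 100 (planeCard n E) i)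
        (range (n + 1 - 100))))
    rw [card_range] at h2
    omega
  rw [mem_inter, mem_filter, mem_filter] at hi
  have h1 : windowAverage 100 (fun q => planeCard n D q + planeCard n E q) i ≤ (n : ℝ) ^ 2 := by
    refine windowAverage_le (by norm_num) fun q _ => ?_
    have : planeCard n D q + planeCard n E q ≤ n ^ 2 := by
      rw [planeCard, planeCard, ← sum_add_distrib, sq]
      refine (sum_le_card_nsmul _ _ n fun y _ => ?_).trans (by simp)
      rw [← card_union_of_disjoint]
      · exact (card_le_card (union_subset (filter_subset _ _) (filter_subset _ _))).trans (by simp)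
      · rw [disjoint_filter]
        exact fun x _ h => hne q y x h
    exact_mod_cast this
  rw [windowAverage_add] at h1
  linarith [hi.1.2, hi.2.2]

section Shelter

variable {ι : Type*} [Fintype ι]

/-- The cops that can reach the slab of thickness `100` at height `i` in one move. -/
def slabCops (cz : ι → ℕ) (i : ℕ) : Finset ι := {j | i ≤ cz j + 1 ∧ cz j ≤ i + 100}

/-- The cops that can reach a tube with a `100 × 100` cross-section in one move. -/
def tubeCops (cz cy : ι → ℕ) (z y : ℕ) : Finset ι :=
  {j ∈ slabCops cz z | y ≤ cy j + 1 ∧ cy j ≤ y + 100}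

/-- A position for the robber from which, after any move of the cops, he is connected to most of
the grid. -/
structure IsShelter (n : ℕ) (cz cy cx : ι → ℕ) (z₀ y₀ x₀ : ℕ) : Prop where
  z_le : z₀ + 100 ≤ n
  y_le : y₀ + 100 ≤ n
  x_lt : x₀ < n
  slab_min : ∀ i < n + 1 - 100, #(slabCops cz z₀) ≤ #(slabCops cz i)
  slab_le : #(slabCops cz z₀) ≤ 74 * n
  tube_lt : #(tubeCops cz cy z₀ y₀) < 10000
  free : ∀ j ∈ tubeCops cz cy z₀ y₀, ¬ (x₀ ≤ cx j + 1 ∧ cx j ≤ x₀ + 1)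

theorem exists_isShelter {n : ℕ} (hn : 40000 ≤ n)
    (hk : 10000 * Fintype.card ι ≤ 7172 * n ^ 2) (cz cy cx : ι → ℕ) :
    ∃ z₀ y₀ x₀, IsShelter n cz cy cx z₀ y₀ x₀ := by
  obtain ⟨m, rfl⟩ : ∃ m, n = m + 99 := ⟨n - 99, by omega⟩
  have hm : m + 99 + 1 - 100 = m := by omega
  obtain ⟨z₀, hz₀, hmin, hz⟩ := exists_window_min (univ : Finset ι) cz (N := m) 100 (by omega)
  obtain ⟨y₀, hy₀, -, hy⟩ := exists_window_min (slabCops cz z₀) cy (N := m) 100 (by omega)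
  have hz : m * #(slabCops cz z₀) ≤ 102 * Fintype.card ι := hz
  have hy : m * #(tubeCops cz cy z₀ y₀) ≤ 102 * #(slabCops cz z₀) := hy
  have h1 : #(slabCops cz z₀) ≤ 74 * (m + 99) := by
    by_contra! h
    have h2 : m * (74 * (m + 99)) ≤ m * #(slabCops cz z₀) := Nat.mul_le_mul_left _ h.le
    nlinarith
  have h2 : #(tubeCops cz cy z₀ y₀) < 10000 := by
    by_contra! h
    have h2 : m * 10000 ≤ m * #(tubeCops cz cy z₀ y₀) := Nat.mul_le_mul_left _ h
    omega
  obtain ⟨x₀, hx₀, hx⟩ := exists_lt_notMem_image (J := tubeCops cz cy z₀ y₀ ×ˢ range 3)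
    (n := m + 99) (fun p => cx p.1 + p.2 - 1) (by rw [card_product, card_range]; omega)
  refine ⟨z₀, y₀, x₀, by omega, by omega, hx₀, ?_, h1, h2, fun j hj ⟨ha, hb⟩ => ?_⟩
  · rw [hm]; exact hmin
  · refine hx (j, x₀ + 1 - cx j) ?_ ?_
    · rw [mem_product, mem_range]
      exact ⟨hj, by simp only; omega⟩
    · simp only; omega

/-- Two numbers that differ by at most one. -/
def Near (a b : ℕ) : Prop := a ≤ b + 1 ∧ b ≤ a + 1

variable {n : ℕ} {cz cy cx cz' cy' cx' : ι → ℕ} {z₀ y₀ x₀ : ℕ}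

theorem mem_slabCops_of_near {i : ℕ} {j : ι} (hz : Near (cz j) (cz' j)) (h : i ≤ cz' j)
    (h' : cz' j < i + 100) : j ∈ slabCops cz i := by
  unfold Near at hz
  rw [slabCops, mem_filter]
  exact ⟨mem_univ _, by omega⟩

theorem sum_copCard_le_slabCops (hz : ∀ j, Near (cz j) (cz' j)) (i : ℕ) :
    ∑ q ∈ Ico i (i + 100), copCard cz' q ≤ #(slabCops cz i) := by
  rw [sum_copCard_window]
  refine card_le_card fun j hj => ?_
  rw [mem_filter] at hj
  exact mem_slabCops_of_near (hz j) hj.2.1 hj.2.2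

theorem exists_copCard_le (hz : ∀ j, Near (cz j) (cz' j)) (i : ℕ) :
    ∃ z ∈ Ico i (i + 100), 100 * copCard cz' z ≤ #(slabCops cz i) := by
  refine exists_le_of_sum_le (g := fun _ => #(slabCops cz i)) (by simp) ?_
  rw [← mul_sum, sum_const, Nat.card_Ico, smul_eq_mul, Nat.add_sub_cancel_left]
  exact Nat.mul_le_mul_left _ (sum_copCard_le_slabCops hz i)

theorem IsShelter.mem_tubeCops (hz : ∀ j, Near (cz j) (cz' j)) (hy : ∀ j, Near (cy j) (cy' j))
    {j : ι} (h1 : z₀ ≤ cz' j) (h2 : cz' j < z₀ + 100) (h3 : y₀ ≤ cy' j) (h4 : cy' j < y₀ + 100) :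
    j ∈ tubeCops cz cy z₀ y₀ := by
  rw [tubeCops, mem_filter]
  refine ⟨mem_slabCops_of_near (hz j) h1 h2, ?_⟩
  have := hy j
  unfold Near at this
  omega

theorem IsShelter.not_occ (h : IsShelter n cz cy cx z₀ y₀ x₀) (hz : ∀ j, Near (cz j) (cz' j))
    (hy : ∀ j, Near (cy j) (cy' j)) (hx : ∀ j, Near (cx j) (cx' j)) {z y : ℕ} (h1 : z₀ ≤ z)
    (h2 : z < z₀ + 100) (h3 : y₀ ≤ y) (h4 : y < y₀ + 100) : ¬ Occ cz' cy' cx' z y x₀ := by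
  rintro ⟨j, rfl, rfl, hj⟩
  refine h.free j (IsShelter.mem_tubeCops hz hy h1 h2 h3 h4) ?_
  have := hx j
  unfold Near at this
  omega

/-- The component of a shelter fills most of some plane with few cops. -/
theorem IsShelter.exists_plane (h : IsShelter n cz cy cx z₀ y₀ x₀) (hn : 40000 ≤ n)
    (hz : ∀ j, Near (cz j) (cz' j)) (hy : ∀ j, Near (cy j) (cy' j))
    (hx : ∀ j, Near (cx j) (cx' j)) {D : ℕ → ℕ → ℕ → Prop}
    (hD : ClosedOff n (Occ cz' cy' cx') D) (h₀ : D z₀ y₀ x₀) :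
    ∃ z ∈ Ico z₀ (z₀ + 100), 100 * copCard cz' z ≤ #(slabCops cz z₀) ∧
      (n : ℝ) ^ 2 - planeCard n D z ≤ (copCard cz' z + 1) ^ 2 / 2 := by
  classical
  obtain ⟨z₁, hz₁, hs⟩ := exists_copCard_le hz z₀
  refine ⟨z₁, hz₁, hs, ?_⟩
  rw [mem_Ico] at hz₁
  have hzn := h.z_le
  have hyn := h.y_le
  have hxn := h.x_lt
  have hs1 := h.slab_le
  have hs2 := h.tube_lt
  -- a free line along the tube
  obtain ⟨⟨z, y⟩, hzy, hfree⟩ := exists_mem_notMem_of_card_lt_card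
    (s := (tubeCops cz cy z₀ y₀).image fun j => (cz' j, cy' j))
    (t := Ico z₀ (z₀ + 100) ×ˢ Ico y₀ (y₀ + 100))
    (by
      rw [card_product, Nat.card_Ico, Nat.card_Ico, Nat.add_sub_cancel_left,
        Nat.add_sub_cancel_left]
      exact card_image_le.trans_lt hs2)
  rw [mem_product, mem_Ico, mem_Ico] at hzy
  have hline : ∀ x < n, ¬ Occ cz' cy' cx' z y x := by
    rintro x - ⟨j, h1, h2, -⟩
    refine hfree (mem_image.mpr ⟨j, IsShelter.mem_tubeCops hz hy ?_ ?_ ?_ ?_, by rw [h1, h2]⟩) <;>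
      omega
  -- a position along the tube where the plane `z₁` can be reached and has a free line
  obtain ⟨x, hxn', hxfree⟩ := exists_lt_notMem_image (n := n)
    (J := tubeCops cz cy z₀ y₀ ∪ ({j | cz' j = z₁} : Finset ι)) cx' (by
      refine (card_union_le _ _).trans_lt ?_
      change _ + copCard cz' z₁ < n
      omega)
  obtain ⟨y₁, hy₁, hyfree⟩ := exists_lt_notMem_image (n := n)
    (J := ({j | cz' j = z₁} : Finset ι)) cy' (by change copCard cz' z₁ < n; omega)
  have hcol : ∀ y < n, ¬ Occ cz' cy' cx' z₁ y x := by
    rintro y - ⟨j, h1, -, h2⟩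
    exact hxfree j (by simp [h1]) h2
  have hrow : ∀ x < n, ¬ Occ cz' cy' cx' z₁ y₁ x := by
    rintro x - ⟨j, h1, h2, -⟩
    exact hyfree j (by simp [h1]) h2
  have e1 : D z y₀ x₀ := (hD.lineZ (a := z₀) (b := z₀ + 100) hzn (by omega) hxn
    (fun q h1 h2 => h.not_occ hz hy hx h1 h2 le_rfl (by omega)) le_rfl (by omega)
    hzy.1.1 hzy.1.2).mp h₀
  have e2 : D z y x₀ := (hD.lineY (a := y₀) (b := y₀ + 100) hyn (by omega) hxn
    (fun q h1 h2 => h.not_occ hz hy hx hzy.1.1 hzy.1.2 h1 h2) le_rfl (by omega)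
    hzy.2.1 hzy.2.2).mp e1
  have e3 : D z y x := (hD.lineX (by omega) (by omega) hline hxn hxn').mp e2
  have e4 : D z₁ y x := (hD.lineZ (a := z₀) (b := z₀ + 100) hzn (by omega) hxn'
    (by
      rintro q h1 h2 ⟨j, rfl, rfl, hj⟩
      exact hxfree j (mem_union_left _
        (IsShelter.mem_tubeCops hz hy h1 h2 hzy.2.1 hzy.2.2)) hj)
    hzy.1.1 hzy.1.2 hz₁.1 hz₁.2).mp e3
  have e5 : D z₁ y₁ x := (hD.lineY (a := 0) (b := n) le_rfl (by omega) hxn'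
    (fun q _ h2 => hcol q h2) (Nat.zero_le _) (by omega) (Nat.zero_le _) hy₁).mp e4
  exact hD.sq_sub_planeCard_le (by omega) hy₁ hxn' hrow hcol e5

theorem IsShelter.isBig (h : IsShelter n cz cy cx z₀ y₀ x₀) (hn : 40000 ≤ n)
    (hk : 10000 * Fintype.card ι ≤ 7172 * n ^ 2)
    (hz : ∀ j, Near (cz j) (cz' j)) (hy : ∀ j, Near (cy j) (cy' j))
    (hx : ∀ j, Near (cx j) (cx' j)) {D : ℕ → ℕ → ℕ → Prop}
    (hD : ClosedOff n (Occ cz' cy' cx') D) (h₀ : D z₀ y₀ x₀) : IsBig n D := by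
  classical
  by_contra hbig
  rw [IsBig, not_lt] at hbig
  have hup : ∀ z, z + 1 < n → planeCard n D z ≤ planeCard n D (z + 1) + copCard cz' (z + 1) :=
    fun z hz => hD.planeCard_le_succ hz
  have hdown : ∀ z, z + 1 < n → planeCard n D (z + 1) ≤ planeCard n D z + copCard cz' z :=
    fun z hz => hD.planeCard_succ_le hz
  have havg : ∀ i, windowAverage 100 (copCard cz') i ≤ (#(slabCops cz i) : ℝ) / 100 := by
    intro i
    have h1 := sum_copCard_le_slabCops hz i
    have h2 : ∑ q ∈ Ico i (i + 100), (copCard cz' q : ℝ) ≤ #(slabCops cz i) := by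
      exact_mod_cast h1
    unfold windowAverage
    push_cast
    linarith
  obtain ⟨z₁, hz₁, hs₁, hd₁⟩ := h.exists_plane hn hz hy hx hD h₀
  have hu := (window_slice_bound (by norm_num) hup hdown h.z_le (sum_copCard_le_slabCops hz z₀)
    hz₁ hs₁).2 hd₁
  push_cast at hu
  have hnR : (40000 : ℝ) ≤ n := by exact_mod_cast hn
  have hF : (#(slabCops cz z₀) : ℝ) ≤ 74 * n := by exact_mod_cast h.slab_le
  have hF0 : (0 : ℝ) ≤ #(slabCops cz z₀) := by positivity
  have hzn := h.z_le
  obtain ⟨w, huw, hwn, hw⟩ := sum_lower_bound (N := n + 1 - 100)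
    (s := fun i => (#(slabCops cz i) : ℝ) / 100)
    (d := windowAverage 100 (planeCard n D)) (n := n) (C := 100 + 1)
    (u := (#(slabCops cz z₀) : ℝ) / 100) (by norm_num) (by positivity) (by linarith)
    (fun i hi => by
      have : (#(slabCops cz z₀) : ℝ) ≤ #(slabCops cz i) := by exact_mod_cast h.slab_min i hi
      linarith)
    (fun i _ => le_windowAverage (by norm_num) fun q _ => by positivity)
    (fun i _ => windowAverage_le (by norm_num) fun q _ => by exact_mod_cast planeCard_le_sq q)
    (fun i hi => by
      have h1 : windowAverage 100 (planeCard n D) i ≤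
          windowAverage 100 (fun q => planeCard n D (q + 1) + copCard cz' (q + 1)) i :=
        windowAverage_mono fun q hq => hup q (by rw [mem_Ico] at hq; omega)
      rw [windowAverage_add, ← windowAverage_succ, ← windowAverage_succ] at h1
      linarith [havg (i + 1)])
    (fun i hi => by
      have h1 : windowAverage 100 (fun q => planeCard n D (q + 1)) i ≤
          windowAverage 100 (fun q => planeCard n D q + copCard cz' q) i :=
        windowAverage_mono fun q hq => hdown q (by rw [mem_Ico] at hq; omega)
      rw [windowAverage_add, ← windowAverage_succ] at h1
      linarith [havg i])
    (fun i hi => by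
      obtain ⟨z, hz', hs⟩ := exists_copCard_le hz i
      have hzn : z < n := by rw [mem_Ico] at hz'; omega
      have hb := window_slice_bound (by norm_num) hup hdown (show i + 100 ≤ n by omega)
        (sum_copCard_le_slabCops hz i) hz' hs
      push_cast at hb
      exact (hD.planeCard_dichotomy hzn).imp hb.1 hb.2)
    (i₀ := z₀) (by omega) hu (by nlinarith) hbig
  have hsum : ∑ i ∈ range (n + 1 - 100), (#(slabCops cz i) : ℝ) ≤ 102 * Fintype.card ι := by
    have := sum_card_window_le (univ : Finset ι) cz (n + 1 - 100) 100
    exact_mod_cast this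
  have hk' : 10000 * (Fintype.card ι : ℝ) ≤ 7172 * n ^ 2 := by exact_mod_cast hk
  have hN : ((n + 1 - 100 : ℕ) : ℝ) = n - 99 := by
    rw [Nat.cast_sub (by omega)]; push_cast; ring
  rw [← sum_div, hN] at hw
  set u : ℝ := (#(slabCops cz z₀) : ℝ) / 100 with hudef
  have hun : u ≤ n := huw.trans hwn
  nlinarith [sq_nonneg (n - 2 * u), sq_nonneg (n - 2 * w)]

end Shelter

variable {n k : ℕ}

/-- The vertices that the robber can reach from `r` when cops stand on `S`. -/
def reach {V : Type*} (G : SimpleGraph V) (S : Set V) (r : V) : Set V :=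
  {v | ∃ p : G.Walk r v, ∀ x ∈ p.support, x ∉ S}

theorem mem_reach_self {V : Type*} {G : SimpleGraph V} {S : Set V} {r : V} (h : r ∉ S) :
    r ∈ reach G S r := ⟨.nil, by simpa using h⟩

theorem mem_reach_of_adj {V : Type*} {G : SimpleGraph V} {S : Set V} {r u v : V}
    (hu : u ∈ reach G S r) (h : G.Adj u v) (hv : v ∉ S) : v ∈ reach G S r := by
  obtain ⟨p, hp⟩ := hu
  refine ⟨p.concat h, fun x hx => ?_⟩
  rw [SimpleGraph.Walk.support_concat, List.mem_append, List.mem_singleton] at hx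
  rcases hx with hx | rfl
  · exact hp x hx
  · exact hv

/-- The vertex with the given coordinates belongs to `A`. -/
def Cell (A : Set (Fin n × Fin n × Fin n)) (z y x : ℕ) : Prop :=
  ∃ (hz : z < n) (hy : y < n) (hx : x < n), ((⟨z, hz⟩, ⟨y, hy⟩, ⟨x, hx⟩) : Fin n × Fin n × Fin n) ∈ A

theorem cell_val {A : Set (Fin n × Fin n × Fin n)} {v : Fin n × Fin n × Fin n} :
    Cell A v.1 v.2.1 v.2.2 ↔ v ∈ A :=
  ⟨fun ⟨_, _, _, h⟩ => h, fun h => ⟨v.1.2, v.2.1.2, v.2.2.2, h⟩⟩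

theorem occ_iff_cell (c : Fin k → Fin n × Fin n × Fin n) (z y x : ℕ) :
    Occ (fun j => ((c j).1 : ℕ)) (fun j => ((c j).2.1 : ℕ)) (fun j => ((c j).2.2 : ℕ)) z y x ↔
      Cell (Set.range c) z y x := by
  constructor
  · rintro ⟨j, rfl, rfl, rfl⟩
    exact cell_val.mpr ⟨j, rfl⟩
  · rintro ⟨hz, hy, hx, j, hj⟩
    exact ⟨j, by simp [hj], by simp [hj], by simp [hj]⟩

theorem cell_reach_iff {S : Set (Fin n × Fin n × Fin n)} {r : Fin n × Fin n × Fin n}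
    {z y x z' y' x' : ℕ} (hz : z < n) (hy : y < n) (hx : x < n) (hz' : z' < n) (hy' : y' < n)
    (hx' : x' < n)
    (hadj : (grid3 n).Adj (⟨z, hz⟩, ⟨y, hy⟩, ⟨x, hx⟩) (⟨z', hz'⟩, ⟨y', hy'⟩, ⟨x', hx'⟩))
    (h : ¬ Cell S z y x) (h' : ¬ Cell S z' y' x') :
    Cell (reach (grid3 n) S r) z y x ↔ Cell (reach (grid3 n) S r) z' y' x' :=
  ⟨fun ⟨_, _, _, hr⟩ => ⟨hz', hy', hx', mem_reach_of_adj hr hadj fun hS => h' ⟨hz', hy', hx', hS⟩⟩,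
    fun ⟨_, _, _, hr⟩ => ⟨hz, hy, hx, mem_reach_of_adj hr hadj.symm fun hS => h ⟨hz, hy, hx, hS⟩⟩⟩

theorem closedOff_reach (c : Fin k → Fin n × Fin n × Fin n) (r : Fin n × Fin n × Fin n) :
    ClosedOff n (Occ (fun j => ((c j).1 : ℕ)) (fun j => ((c j).2.1 : ℕ))
      (fun j => ((c j).2.2 : ℕ))) (Cell (reach (grid3 n) (Set.range c) r)) where
  disj := by
    rintro z y x ⟨hz, hy, hx, p, hp⟩ hO
    obtain ⟨_, _, _, h⟩ := (occ_iff_cell c z y x).mp hO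
    exact hp _ p.end_mem_support h
  stepZ z y x hz hy hx h h' := by
    rw [occ_iff_cell] at h h'
    refine cell_reach_iff (by omega) hy hx hz hy hx ?_ h h'
    simp [SimpleGraph.boxProd_adj, SimpleGraph.pathGraph_adj]
  stepY z y x hz hy hx h h' := by
    rw [occ_iff_cell] at h h'
    refine cell_reach_iff hz (by omega) hx hz hy hx ?_ h h'
    simp [SimpleGraph.boxProd_adj, SimpleGraph.pathGraph_adj]
  stepX z y x hz hy hx h h' := by
    rw [occ_iff_cell] at h h'
    refine cell_reach_iff hz hy (by omega) hz hy hx ?_ h h'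
    simp [SimpleGraph.boxProd_adj, SimpleGraph.pathGraph_adj]

theorem near_of_move {u v : Fin n × Fin n × Fin n} (h : v = u ∨ (grid3 n).Adj u v) :
    Near u.1 v.1 ∧ Near u.2.1 v.2.1 ∧ Near u.2.2 v.2.2 := by
  unfold Near
  rcases h with rfl | h
  · omega
  · simp only [SimpleGraph.boxProd_adj, SimpleGraph.pathGraph_adj] at h
    rcases h with ⟨h1, h2⟩ | ⟨⟨h1, h2⟩ | ⟨h1, h2⟩, h3⟩
    · rw [h2]; omega
    · rw [h2, h3]; omega
    · rw [h2, h3]; omega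

/-- Every placement of few cops leaves a vertex that remains, after any move of the cops, in the
component that fills most of the grid. -/
theorem exists_robber_position (hn : 40000 ≤ n) (hk : 10000 * k ≤ 7172 * n ^ 2)
    (c : Fin k → Fin n × Fin n × Fin n) :
    ∃ r, ∀ c' : Fin k → Fin n × Fin n × Fin n,
      (∀ j, c' j = c j ∨ (grid3 n).Adj (c j) (c' j)) →
      r ∉ Set.range c' ∧ IsBig n (Cell (reach (grid3 n) (Set.range c') r)) := by
  have hk' : 10000 * Fintype.card (Fin k) ≤ 7172 * n ^ 2 := by rwa [Fintype.card_fin]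
  obtain ⟨z₀, y₀, x₀, h⟩ := exists_isShelter hn hk' (fun j => ((c j).1 : ℕ))
    (fun j => ((c j).2.1 : ℕ)) (fun j => ((c j).2.2 : ℕ))
  have hz := h.z_le
  have hy := h.y_le
  have hx := h.x_lt
  refine ⟨(⟨z₀, by omega⟩, ⟨y₀, by omega⟩, ⟨x₀, hx⟩), fun c' hc => ?_⟩
  have hnz := fun j => (near_of_move (hc j)).1
  have hny := fun j => (near_of_move (hc j)).2.1
  have hnx := fun j => (near_of_move (hc j)).2.2
  have hr : ((⟨z₀, by omega⟩, ⟨y₀, by omega⟩, ⟨x₀, hx⟩) : Fin n × Fin n × Fin n) ∉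
      Set.range c' := by
    have := h.not_occ hnz hny hnx le_rfl (by omega) le_rfl (by omega)
    rw [occ_iff_cell] at this
    exact fun h => this ⟨_, _, _, h⟩
  exact ⟨hr, h.isBig hn hk' hnz hny hnx (closedOff_reach c' _) ⟨_, _, _, mem_reach_self hr⟩⟩

/-- The robber's positions when he answers each placement `c` of the cops by going to `ρ c`. -/
def robberHistory {V : Type*} (σ : CopStrategy V k) (ρ : (Fin k → V) → V) : ℕ → List V
  | 0 => []
  | i + 1 => robberHistory σ ρ i ++ [ρ (σ (robberHistory σ ρ i))]

theorem map_range_robberHistory {V : Type*} (σ : CopStrategy V k) (ρ : (Fin k → V) → V) (i : ℕ) :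
    (List.range i).map (fun i => ρ (σ (robberHistory σ ρ i))) = robberHistory σ ρ i := by
  induction i with
  | zero => rfl
  | succ i ih => rw [List.range_succ, List.map_append, ih]; rfl

theorem not_copsWin (hn : 40000 ≤ n) (hk : 10000 * k ≤ 7172 * n ^ 2) :
    ¬ CopsWin (grid3 n) k := by
  classical
  rintro ⟨σ, hσ, hwin⟩
  choose ρ hρ using exists_robber_position (k := k) hn hk
  refine hwin (fun i => ρ (σ (robberHistory σ ρ i))) ⟨?_, fun i => ?_⟩
  · rw [CopStrategy.occupied, map_range_robberHistory]
    exact (hρ _ _ fun _ => Or.inl rfl).1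
  · rw [CopStrategy.occupied, map_range_robberHistory]
    set c := σ (robberHistory σ ρ i)
    set c' := σ (robberHistory σ ρ (i + 1))
    obtain ⟨-, h1⟩ := hρ c c' fun j => hσ _ _ j
    obtain ⟨-, h2⟩ := hρ c' c' fun _ => Or.inl rfl
    obtain ⟨z, y, x, ⟨_, _, _, p, hp⟩, ⟨_, _, _, q, hq⟩⟩ := h1.exists_common h2
    refine ⟨(p.append q.reverse).bypass, SimpleGraph.Walk.bypass_isPath _, fun v hv => ?_⟩
    have hv := SimpleGraph.Walk.support_bypass_subset_support _ hv
    rw [SimpleGraph.Walk.mem_support_append_iff, SimpleGraph.Walk.support_reverse,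
      List.mem_reverse] at hv
    exact hv.elim (hp v) (hq v)

end CopsRobber

theorem theorem3p6 :
    ∃ N : ℕ, ∀ n : ℕ, N ≤ n →
      (0.7172 : ℝ) * (n : ℝ) ^ 2 <
        (CopsRobber.infSpeedCopNumber (CopsRobber.grid3 n) : ℝ) := by
  refine ⟨40000, fun n hn => ?_⟩
  by_contra! h
  have hmem : CopsRobber.CopsWin (CopsRobber.grid3 n)
      (CopsRobber.infSpeedCopNumber (CopsRobber.grid3 n)) :=
    Nat.sInf_mem (s := {k | CopsRobber.CopsWin (CopsRobber.grid3 n) k})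
      ⟨_, CopsRobber.copsWin_card _⟩
  refine CopsRobber.not_copsWin hn ?_ hmem
  have : 10000 * (CopsRobber.infSpeedCopNumber (CopsRobber.grid3 n) : ℝ) ≤ 7172 * n ^ 2 := by
    linarith
  exact_mod_cast this
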